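/- Let $\mathbb X,\mathbb U,\mathcal M$ be finite non-empty sets (states, control actions, channel symbols), let $c:\mathbb X\times\mathbb U\to\mathbb R$ be a cost function and let $\beta\in(0,1)$. Consider the controlled Markov source $$x_{t+1}=f(x_t,u_t,w_t),\qquad t\ge 0,$$ where $w_0,w_1,\dots$ are i.i.d. random variables in a measurable space $\mathbb W$, $f(x,u,\cdot)$ is measurable for all $(x,u)$, and $x_0$ has law $\pi_0\in\mathcal P(\mathbb X)$ and is independent of $(w_t)_{t\ge0}$. An admissible joint coding–control policy $\bar\gamma\in\Gamma_A$ is a sequence of maps $(\gamma^e_t,\gamma^c_t)_{t\ge 0}$ generating $q_t=\gamma^e_t(x_{[0,t]},q_{[0,t-1]})\in\mathcal M$ and $u_t=\gamma^c_t(q_{[0,t]},u_{[0,t-1]})\in\mathbb U$. Its discounted cost is $$J_\beta(\pi_0,\bar\gamma)=\lim_{N\to\infty}E^{\bar\gamma}_{\pi_0}\Big[\sum_{k=0}^{N-1}\beta^k c(x_k,u_k)\Big].$$ Let $\pi_t(\cdot)=P^{\bar\gamma}_{\pi_0}(x_t=\cdot\mid q_{[0,t-1]})\in\mathcal P(\mathbb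 X)$ be the predictor (set to $\pi_0$ on realizations of $q_{[0,t-1]}$ of probability zero), let $\mathcal Q$ be the set of quantizers $Q:\mathbb X\to\mathcal M$ and $\mathcal H$ the set of maps $\eta:\mathcal Q\times\mathcal M\to\mathbb U$. A policy belongs to $\Gamma_{C\text{-}P}$ (controlled-predictor structure) if there are measurable maps $g_t:\mathcal P(\mathbb X)\to\mathcal Q\times\mathcal H$ such that, with $(Q_t,\eta_t)=g_t(\pi_t)$, it generates $q_t=Q_t(x_t)$ and $u_t=\eta_t(Q_t,q_t)$ for all $t\ge0$; it is stationary if $g_t=g$ does not depend on $t$. Theorem. The limit defining $J_\beta(\pi_0,\bar\gamma)$ exists for all $\pi_0$ and all $\bar\gamma\in\Gamma_A$, and there is a measurable map $g:\mathcal P(\mathbb X)\to\mathcal Q\times\mathcal H$ such that for every initial law $\pi_0$ the stationary policy $\bar\gamma^*\in\Gamma_{C\text{-}P}$ given by $g$ is optimal among all admissible policies: $$J_\beta(\pi_0,\bar\gamma^*)=\min_{\bar\gamma\in\Gamma_A}J_\beta(\pi_0,\bar\gamma).$$ Moreover, with $\tilde c(\pi,Q,\eta)=\sum_{x\in\mathbb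 X}\pi(x)\,c\big(x,\eta(Q,Q(x))\big)$, this optimal cost equals $\lim_{N\to\infty}E^{\bar\gamma^*}_{\pi_0}\big[\sum_{k=0}^{N-1}\beta^k\tilde c(\pi_k,Q_k,\eta_k)\big]$. -/

import Mathlib

open MeasureTheory ProbabilityTheory Filter Topology

noncomputable section

namespace CodingControl

/-- The controlled Markov source `x_{t+1} = f(x_t, u_t, w_t)`, where the noise variables `w_t`
are i.i.d. with law `noise`. -/
structure Plant (X U W : Type*) [MeasurableSpace X] [MeasurableSpace W] where
  f : X → U → W → X
  measurable_f : ∀ x u, Measurable (f x u)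
  noise : Measure W
  isProbabilityMeasure_noise : IsProbabilityMeasure noise

/-- An admissible joint coding-control policy: at time `t` the encoder computes
`q_t` from `(x_{[0,t]}, q_{[0,t-1]})`, and the controller computes
`u_t` from `(q_{[0,t]}, u_{[0,t-1]})`. The type `Policy X M U` is the class `Γ_A`. -/
structure Policy (X M U : Type*) where
  enc : (t : ℕ) → (Fin (t + 1) → X) → (Fin t → M) → M
  ctrl : (t : ℕ) → (Fin (t + 1) → M) → (Fin t → U) → U

/-- The finite set `𝒬` of quantizers. -/
abbrev Quantizer (X M : Type*) := X → M

/-- The finite set `ℋ` of control maps `η : (Q, q) ↦ u`. -/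
abbrev ControlMap (X M U : Type*) := Quantizer X M × M → U

section

variable {X M U W : Type*} [MeasurableSpace X] [MeasurableSpace W]

/-- The probability space carrying `x₀ ∼ π₀` and, independently of it, the i.i.d. noise
`w₀, w₁, …`. -/
def Plant.prob (S : Plant X U W) (π₀ : ProbabilityMeasure X) : Measure (X × (ℕ → W)) :=
  haveI := S.isProbabilityMeasure_noise
  (π₀ : Measure X).prod (Measure.infinitePi fun _ : ℕ => S.noise)

instance (S : Plant X U W) (π₀ : ProbabilityMeasure X) : IsProbabilityMeasure (S.prob π₀) := by
  haveI := S.isProbabilityMeasure_noise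
  unfold Plant.prob
  infer_instance

/-- One step of the closed loop, on histories `(x_{[0,t]}, q_{[0,t-1]}, u_{[0,t-1]})`. -/
def Plant.step (S : Plant X U W) (γ : Policy X M U) (t : ℕ)
    (h : (Fin (t + 1) → X) × (Fin t → M) × (Fin t → U)) (w : W) :
    (Fin (t + 2) → X) × (Fin (t + 1) → M) × (Fin (t + 1) → U) :=
  let q : Fin (t + 1) → M := Fin.snoc h.2.1 (γ.enc t h.1 h.2.1)
  let u : U := γ.ctrl t q h.2.2
  (Fin.snoc h.1 (S.f (h.1 (Fin.last t)) u w), q, Fin.snoc h.2.2 u)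

/-- The closed-loop history `(x_{[0,t]}, q_{[0,t-1]}, u_{[0,t-1]})` under the policy `γ`. -/
def Plant.hist (S : Plant X U W) (γ : Policy X M U) (ω : X × (ℕ → W)) :
    (t : ℕ) → (Fin (t + 1) → X) × (Fin t → M) × (Fin t → U)
  | 0 => (fun _ => ω.1, Fin.elim0, Fin.elim0)
  | t + 1 => S.step γ t (S.hist γ ω t) (ω.2 t)

/-- The state `x_t`. -/
def Plant.state (S : Plant X U W) (γ : Policy X M U) (t : ℕ) (ω : X × (ℕ → W)) : X :=
  (S.hist γ ω t).1 (Fin.last t)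

/-- The past channel symbols `q_{[0,t-1]}`. -/
def Plant.pastSymbols (S : Plant X U W) (γ : Policy X M U) (t : ℕ) (ω : X × (ℕ → W)) :
    Fin t → M :=
  (S.hist γ ω t).2.1

/-- The control action `u_t`. -/
def Plant.action (S : Plant X U W) (γ : Policy X M U) (t : ℕ) (ω : X × (ℕ → W)) : U :=
  (S.hist γ ω (t + 1)).2.2 (Fin.last t)

theorem Plant.measurable_state [Finite X] [DiscreteMeasurableSpace X] [Finite M] [Finite U]
    (S : Plant X U W) (γ : Policy X M U) (t : ℕ) : Measurable (S.state γ t) := by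
  have key : ∀ t, ∀ h, MeasurableSet {ω | S.hist γ ω t = h} := by
    intro t
    induction t with
    | zero =>
      intro h
      have : {ω : X × (ℕ → W) | S.hist γ ω 0 = h}
          = Prod.fst ⁻¹' {x : X | ((fun _ => x, Fin.elim0, Fin.elim0) :
              (Fin 1 → X) × (Fin 0 → M) × (Fin 0 → U)) = h} := rfl
      rw [this]
      exact measurable_fst (MeasurableSet.of_discrete)
    | succ t ih =>
      intro h
      have : {ω : X × (ℕ → W) | S.hist γ ω (t + 1) = h}
          = ⋃ h', ({ω | S.hist γ ω t = h'} ∩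
              (fun ω => ω.2 t) ⁻¹' {w | S.step γ t h' w = h}) := by
        ext ω
        simp [Plant.hist]
      rw [this]
      refine MeasurableSet.iUnion fun h' => (ih h').inter ?_
      refine ((measurable_pi_apply t).comp measurable_snd) ?_
      have hs : {w | S.step γ t h' w = h}
          = S.f (h'.1 (Fin.last t)) (γ.ctrl t (Fin.snoc h'.2.1 (γ.enc t h'.1 h'.2.1)) h'.2.2) ⁻¹'
            {x | ((Fin.snoc h'.1 x, Fin.snoc h'.2.1 (γ.enc t h'.1 h'.2.1),
              Fin.snoc h'.2.2 (γ.ctrl t (Fin.snoc h'.2.1 (γ.enc t h'.1 h'.2.1)) h'.2.2)) :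
              (Fin (t + 2) → X) × (Fin (t + 1) → M) × (Fin (t + 1) → U)) = h} := rfl
      rw [hs]
      exact S.measurable_f _ _ MeasurableSet.of_discrete
  intro s _
  have : S.state γ t ⁻¹' s
      = ⋃ h : {h : (Fin (t + 1) → X) × (Fin t → M) × (Fin t → U) // h.1 (Fin.last t) ∈ s},
          {ω | S.hist γ ω t = h.1} := by
    ext ω
    simp [Plant.state]
  rw [this]
  exact MeasurableSet.iUnion fun h => key t h.1

open Classical in
/-- The predictor `π_t = P^γ(x_t = · | q_{[0,t-1]})` at the realization `q` of `q_{[0,t-1]}`.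
On realizations of probability zero, where the conditional law is undefined, it is set
to `π₀`. -/
def Plant.predictor [Finite X] [DiscreteMeasurableSpace X] [Finite M] [Finite U]
    (S : Plant X U W) (π₀ : ProbabilityMeasure X) (γ : Policy X M U) (t : ℕ) (q : Fin t → M) :
    ProbabilityMeasure X :=
  if hq : S.prob π₀ {ω | S.pastSymbols γ t ω = q} ≠ 0 then
    ⟨(cond (S.prob π₀) {ω | S.pastSymbols γ t ω = q}).map (S.state γ t), by
      haveI := cond_isProbabilityMeasure hq
      exact Measure.isProbabilityMeasure_map (S.measurable_state γ t).aemeasurable⟩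
  else π₀

/-- The policy `γ` has the controlled-predictor structure given by the maps
`g t : π_t ↦ (Q_t, η_t)`: it generates `q_t = Q_t(x_t)` and `u_t = η_t(Q_t, q_t)`, where `π_t`
is the predictor under `γ` itself, started from `π₀`. -/
def Plant.HasControlledPredictorStructure [Finite X] [DiscreteMeasurableSpace X]
    [Finite M] [Finite U] (S : Plant X U W) (π₀ : ProbabilityMeasure X) (γ : Policy X M U)
    (g : ℕ → ProbabilityMeasure X → Quantizer X M × ControlMap X M U) : Prop :=
  (∀ (t : ℕ) (x : Fin (t + 1) → X) (q : Fin t → M),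
    γ.enc t x q = (g t (S.predictor π₀ γ t q)).1 (x (Fin.last t))) ∧
  (∀ (t : ℕ) (q : Fin (t + 1) → M) (u : Fin t → U),
    γ.ctrl t q u =
      (g t (S.predictor π₀ γ t (Fin.init q))).2
        ((g t (S.predictor π₀ γ t (Fin.init q))).1, q (Fin.last t)))

/-- `J_β^N(π₀, γ) = E[∑_{k<N} β^k c(x_k, u_k)]`. -/
def Plant.finiteCost (S : Plant X U W) (c : X → U → ℝ) (β : ℝ) (π₀ : ProbabilityMeasure X)
    (γ : Policy X M U) (N : ℕ) : ℝ :=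
  ∫ ω, ∑ k ∈ Finset.range N, β ^ k * c (S.state γ k ω) (S.action γ k ω) ∂(S.prob π₀)

/-- `J_β(π₀, γ) = lim_{N → ∞} J_β^N(π₀, γ)`. -/
def Plant.discountedCost (S : Plant X U W) (c : X → U → ℝ) (β : ℝ) (π₀ : ProbabilityMeasure X)
    (γ : Policy X M U) : ℝ :=
  limUnder atTop (S.finiteCost c β π₀ γ)

/-- The cost `c̃(π, Q, η)` of the reformulated problem. -/
def reducedCost [Fintype X] (c : X → U → ℝ) (π : ProbabilityMeasure X)
    (a : Quantizer X M × ControlMap X M U) : ℝ :=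
  ∑ x, (π : Measure X).real {x} * c x (a.2 (a.1, a.1 x))

/-- `E[∑_{k<N} β^k c̃(π_k, Q_k, η_k)]`, where `(Q_k, η_k) = g k π_k`. -/
def Plant.finiteReducedCost [Fintype X] [DiscreteMeasurableSpace X] [Finite M] [Finite U]
    (S : Plant X U W) (c : X → U → ℝ) (β : ℝ) (π₀ : ProbabilityMeasure X) (γ : Policy X M U)
    (g : ℕ → ProbabilityMeasure X → Quantizer X M × ControlMap X M U) (N : ℕ) : ℝ :=
  ∫ ω, ∑ k ∈ Finset.range N,
    β ^ k * reducedCost c (S.predictor π₀ γ k (S.pastSymbols γ k ω))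
      (g k (S.predictor π₀ γ k (S.pastSymbols γ k ω))) ∂(S.prob π₀)

end

end CodingControl

end

/-!
Work with the unnormalized predictor `μ = P(x_t = ·, q_{[0,t-1]} = q)`, which lives in the positive
cone of `ℝ^X`. In these variables the new symbol splits `μ` into one part per symbol, and the
Bellman operator preserves superlinearity (superadditivity and positive homogeneity). Value
iteration thus yields a superlinear, hence concave, solution of the Bellman equation.

An admissible encoder splits `μ` into parts `ν_m` with sum `μ` that need not be carried by disjoint
sets, since it may look at past states. Such a splitting is a mixture of quantizers, and a concave
function is minimized at an extreme point, so some quantizer does at least as well. Telescoping the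
Bellman inequality along the closed loop bounds every admissible cost from below by the value
function. By homogeneity an action that is greedy at the normalized predictor is greedy at `μ`, so
the greedy stationary policy turns every inequality into an equality.
-/

noncomputable section

namespace CodingControl

open scoped Matrix

section Superlinear

/-- Superlinear (superadditive and positively homogeneous) functions on the positive cone of an
ordered vector space. Nothing is required off the cone. -/
structure IsSuperlinear {E : Type*} [AddCommMonoid E] [Preorder E] [SMul ℝ E] (v : E → ℝ) :
    Prop where
  le_map_add : ∀ ⦃μ ν⦄, 0 ≤ μ → 0 ≤ ν → v μ + v ν ≤ v (μ + ν)
  map_smul : ∀ ⦃r : ℝ⦄ ⦃μ⦄, 0 ≤ r → 0 ≤ μ → v (r • μ) = r * v μ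

namespace IsSuperlinear

variable {E F ι : Type*} [AddCommMonoid E] [Module ℝ E] [AddCommMonoid F] [Module ℝ F]

theorem concaveOn [PartialOrder E] [IsOrderedAddMonoid E] [PosSMulMono ℝ E] {v : E → ℝ}
    (hv : IsSuperlinear v) : ConcaveOn ℝ (Set.Ici 0) v := by
  refine ⟨convex_Ici 0, fun μ hμ ν hν a b ha hb _ => ?_⟩
  rw [smul_eq_mul, smul_eq_mul, ← hv.map_smul ha hμ, ← hv.map_smul hb hν]
  exact hv.le_map_add (smul_nonneg ha hμ) (smul_nonneg hb hν)

variable [Preorder E] [Preorder F]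

theorem of_linearMap (f : E →ₗ[ℝ] ℝ) : IsSuperlinear f where
  le_map_add _ _ _ _ := (f.map_add _ _).ge
  map_smul _ _ _ _ := f.map_smul _ _

theorem comp_linearMap {v : F → ℝ} (hv : IsSuperlinear v) {f : E →ₗ[ℝ] F}
    (hf : ∀ μ, 0 ≤ μ → 0 ≤ f μ) : IsSuperlinear fun μ => v (f μ) where
  le_map_add μ ν hμ hν := by
    simpa only [map_add] using hv.le_map_add (hf μ hμ) (hf ν hν)
  map_smul r μ hr hμ := by
    simpa only [LinearMap.map_smul] using hv.map_smul hr (hf μ hμ)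

theorem add {v w : E → ℝ} (hv : IsSuperlinear v) (hw : IsSuperlinear w) :
    IsSuperlinear fun μ => v μ + w μ where
  le_map_add μ ν hμ hν := by linarith [hv.le_map_add hμ hν, hw.le_map_add hμ hν]
  map_smul r μ hr hμ := by rw [hv.map_smul hr hμ, hw.map_smul hr hμ, mul_add]

theorem const_mul {v : E → ℝ} (hv : IsSuperlinear v) {b : ℝ} (hb : 0 ≤ b) :
    IsSuperlinear fun μ => b * v μ where
  le_map_add μ ν hμ hν := by
    simpa only [mul_add] using mul_le_mul_of_nonneg_left (hv.le_map_add hμ hν) hb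
  map_smul r μ hr hμ := by rw [hv.map_smul hr hμ, mul_left_comm]

theorem sum {v : ι → E → ℝ} {s : Finset ι} (hv : ∀ i ∈ s, IsSuperlinear (v i)) :
    IsSuperlinear fun μ => ∑ i ∈ s, v i μ where
  le_map_add μ ν hμ hν := by
    rw [← Finset.sum_add_distrib]
    exact Finset.sum_le_sum fun i hi => (hv i hi).le_map_add hμ hν
  map_smul r μ hr hμ := by
    rw [Finset.mul_sum]
    exact Finset.sum_congr rfl fun i hi => (hv i hi).map_smul hr hμ

theorem iInf [Finite ι] [Nonempty ι] {v : ι → E → ℝ} (hv : ∀ i, IsSuperlinear (v i)) :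
    IsSuperlinear fun μ => ⨅ i, v i μ where
  le_map_add μ ν hμ hν := le_ciInf fun i =>
    (add_le_add (ciInf_le (Set.finite_range _).bddBelow i)
      (ciInf_le (Set.finite_range _).bddBelow i)).trans ((hv i).le_map_add hμ hν)
  map_smul r μ hr hμ := by
    rw [Real.mul_iInf_of_nonneg hr]
    exact iInf_congr fun i => (hv i).map_smul hr hμ

theorem of_tendsto [IsOrderedAddMonoid E] [PosSMulMono ℝ E] {l : Filter ι} [l.NeBot]
    {v : ι → E → ℝ} {w : E → ℝ} (hv : ∀ i, IsSuperlinear (v i))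
    (hw : ∀ μ, 0 ≤ μ → Tendsto (fun i => v i μ) l (𝓝 (w μ))) : IsSuperlinear w where
  le_map_add μ ν hμ hν :=
    le_of_tendsto_of_tendsto' ((hw μ hμ).add (hw ν hν)) (hw _ (add_nonneg hμ hν))
      fun i => (hv i).le_map_add hμ hν
  map_smul r μ hr hμ :=
    tendsto_nhds_unique (hw _ (smul_nonneg hr hμ))
      (((hw μ hμ).const_mul r).congr fun i => ((hv i).map_smul hr hμ).symm)

end IsSuperlinear

end Superlinear

section Quantizer

variable {X M : Type*}

/-- The part of the weights `μ` carried by the cell `{x | Q x = m}` of the quantizer `Q`. -/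
def cell (Q : Quantizer X M) (m : M) : (X → ℝ) →ₗ[ℝ] X → ℝ where
  toFun := (Q ⁻¹' {m}).indicator
  map_add' := Set.indicator_add _
  map_smul' := Set.indicator_const_smul _

theorem cell_apply [DecidableEq M] (Q : Quantizer X M) (m : M) (μ : X → ℝ) (x : X) :
    cell Q m μ x = if Q x = m then μ x else 0 := by
  simp only [cell, LinearMap.coe_mk, AddHom.coe_mk, Set.indicator, Set.mem_preimage,
    Set.mem_singleton_iff]

theorem cell_nonneg (Q : Quantizer X M) (m : M) {μ : X → ℝ} (hμ : 0 ≤ μ) : 0 ≤ cell Q m μ :=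
  Set.indicator_nonneg fun x _ => hμ x

theorem sum_cell [Fintype M] (Q : Quantizer X M) (μ : X → ℝ) : ∑ m, cell Q m μ = μ := by
  classical
  ext x
  simp only [Finset.sum_apply, cell_apply, Finset.sum_ite_eq, Finset.mem_univ, if_true]

theorem exists_mem_stdSimplex_sum_smul_eq [Fintype M] [Nonempty M] {w : M → ℝ} (hw : 0 ≤ w) :
    ∃ p ∈ stdSimplex ℝ M, (∑ m, w m) • p = w := by
  classical
  rcases (Finset.sum_nonneg fun m _ => hw m).eq_or_lt' with h | h
  · obtain rfl : w = 0 := (Fintype.sum_eq_zero_iff_of_nonneg hw).1 h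
    exact ⟨_, single_mem_stdSimplex ℝ (Classical.arbitrary M), by simp⟩
  · exact ⟨(∑ m, w m)⁻¹ • w,
      ⟨fun m => mul_nonneg (inv_nonneg.2 h.le) (hw m),
        by simp [← Finset.mul_sum, inv_mul_cancel₀ h.ne']⟩, smul_inv_smul₀ h.ne' w⟩

/-- The stochastic kernels from `X` to `M` form a polytope with the quantizers as vertices, and a
concave function on a polytope is minimized at a vertex. -/
theorem exists_quantizer_le_of_concaveOn [Finite X] [Fintype M] [DecidableEq M]
    {f : (X → M → ℝ) → ℝ} (hf : ConcaveOn ℝ (Set.univ.pi fun _ => stdSimplex ℝ M) f)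
    {κ : X → M → ℝ} (hκ : κ ∈ Set.univ.pi fun _ => stdSimplex ℝ M) :
    ∃ Q : Quantizer X M, f (fun x => Pi.single (Q x) 1) ≤ f κ := by
  have hvert : κ ∈ convexHull ℝ
      (Set.univ.pi fun _ : X => Set.range fun m : M => (Pi.single m 1 : M → ℝ)) := by
    simpa only [convexHull_pi, convexHull_rangle_single_eq_stdSimplex] using hκ
  obtain ⟨e, he, hle⟩ := hf.exists_le_of_mem_convexHull
    (Set.pi_mono fun _ _ => Set.range_subset_iff.2 (single_mem_stdSimplex ℝ)) hvert
  choose Q hQ using fun x => he x (Set.mem_univ x)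
  exact ⟨Q, by simpa only [hQ] using hle⟩

theorem exists_quantizer_sum_le [Finite X] [Fintype M] [Nonempty M] {F : M → (X → ℝ) → ℝ}
    (hF : ∀ m, ConcaveOn ℝ (Set.Ici 0) (F m)) {ν : M → X → ℝ} (hν : 0 ≤ ν) :
    ∃ Q : Quantizer X M, ∑ m, F m (cell Q m (∑ m', ν m')) ≤ ∑ m, F m (ν m) := by
  classical
  set μ := ∑ m, ν m with hμ
  have hμ₀ : 0 ≤ μ := Finset.sum_nonneg fun m _ => hν m
  choose κ hκ hκν using fun x => exists_mem_stdSimplex_sum_smul_eq fun m => hν m x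
  let part (m : M) : (X → M → ℝ) →ₗ[ℝ] X → ℝ :=
    { toFun ξ x := μ x * ξ x m
      map_add' ξ ζ := by ext x; exact mul_add _ _ _
      map_smul' r ξ := by ext x; exact mul_left_comm _ _ _ }
  have hpart (m : M) : ConcaveOn ℝ (Set.univ.pi fun _ => stdSimplex ℝ M) (F m ∘ part m) :=
    ((hF m).comp_linearMap (part m)).subset
      (fun ξ hξ x => mul_nonneg (hμ₀ x) ((hξ x (Set.mem_univ x)).1 m))
      (convex_pi fun _ _ => convex_stdSimplex ℝ M)
  have hpart_single (Q : Quantizer X M) (m : M) :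
      part m (fun x => Pi.single (Q x) 1) = cell Q m μ := by
    ext x
    simp [part, cell_apply, Pi.single_apply, eq_comm]
  have hpart_κ (m : M) : part m κ = ν m := by
    ext x
    simpa [part, hμ] using congrFun (hκν x) m
  have hconc := Finset.sum_induction (fun m => F m ∘ part m) (ConcaveOn ℝ _)
    (fun _ _ => ConcaveOn.add) (concaveOn_const 0 (convex_pi fun _ _ => convex_stdSimplex ℝ M))
    fun m (_ : m ∈ Finset.univ) => hpart m
  obtain ⟨Q, hQ⟩ := exists_quantizer_le_of_concaveOn hconc fun x _ => hκ x
  exact ⟨Q, by simpa only [Finset.sum_apply, Function.comp_apply, hpart_single, hpart_κ] using hQ⟩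

end Quantizer

section Bellman

variable {X M U : Type*} [Fintype X] [Fintype M]

/-- The cost of applying the control `u` to a state with weights `ρ`, plus the discounted value `v`
of the weights of the next state, where `K u` is the transition matrix under `u`. -/
def stageValue (c : X → U → ℝ) (K : U → Matrix X X ℝ) (β : ℝ) (v : (X → ℝ) → ℝ) (u : U)
    (ρ : X → ℝ) : ℝ :=
  ρ ⬝ᵥ (fun x => c x u) + β * v (ρ ᵥ* K u)

/-- The cost of using the action `a = (Q, η)` on a state with weights `μ`, plus the discounted value
`v` of the weights that the controller holds after it has seen the channel symbol. -/
def actionValue (c : X → U → ℝ) (K : U → Matrix X X ℝ) (β : ℝ) (v : (X → ℝ) → ℝ)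
    (a : Quantizer X M × ControlMap X M U) (μ : X → ℝ) : ℝ :=
  ∑ m, stageValue c K β v (a.2 (a.1, m)) (cell a.1 m μ)

/-- The Bellman operator of the coding-control problem with channel alphabet `M`, on functions of
unnormalized weights. -/
def bellman (M : Type*) [Fintype M] (c : X → U → ℝ) (K : U → Matrix X X ℝ) (β : ℝ)
    (v : (X → ℝ) → ℝ) (μ : X → ℝ) : ℝ :=
  ⨅ a : Quantizer X M × ControlMap X M U, actionValue c K β v a μ

variable {c : X → U → ℝ} {K : U → Matrix X X ℝ} {β : ℝ} {v w : (X → ℝ) → ℝ}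

theorem sum_cell_dotProduct_one (Q : Quantizer X M) (μ : X → ℝ) :
    ∑ m, cell Q m μ ⬝ᵥ 1 = μ ⬝ᵥ 1 := by
  rw [← sum_dotProduct, sum_cell]

theorem abs_cost_le [Fintype U] (c : X → U → ℝ) (x : X) (u : U) : |c x u| ≤ ‖c‖ :=
  (norm_le_pi_norm (c x) u).trans (norm_le_pi_norm c x)

theorem abs_dotProduct_cost_le [Fintype U] (c : X → U → ℝ) (u : U) {ρ : X → ℝ} (hρ : 0 ≤ ρ) :
    |ρ ⬝ᵥ (fun x => c x u)| ≤ ‖c‖ * (ρ ⬝ᵥ 1) := by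
  rw [dotProduct_one, Finset.mul_sum]
  refine (Finset.abs_sum_le_sum_abs _ _).trans (Finset.sum_le_sum fun x _ => ?_)
  rw [abs_mul, abs_of_nonneg (hρ x), mul_comm]
  exact mul_le_mul_of_nonneg_right (abs_cost_le c x u) (hρ x)

theorem measurable_stageValue (hv : Measurable v) (u : U) : Measurable (stageValue c K β v u) :=
  have hpush : Measurable fun ρ : X → ℝ => ρ ᵥ* K u :=
    (K u).vecMulLinear.continuous_of_finiteDimensional.measurable
  (Continuous.dotProduct continuous_id continuous_const).measurable.add
    ((hv.comp hpush).const_mul β)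

theorem measurable_actionValue (hv : Measurable v) (a : Quantizer X M × ControlMap X M U) :
    Measurable (actionValue c K β v a) :=
  Finset.measurable_fun_sum _ fun m _ => (measurable_stageValue hv _).comp
    (cell a.1 m).continuous_of_finiteDimensional.measurable

theorem measurable_bellman [Finite U] (hv : Measurable v) : Measurable (bellman M c K β v) :=
  .iInf fun a => measurable_actionValue hv a

section RowStochastic

variable [DecidableEq X] (hK : ∀ u, K u ∈ Matrix.rowStochastic ℝ X)
include hK

theorem IsSuperlinear.stageValue (hv : IsSuperlinear v) (hβ : 0 ≤ β) (u : U) :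
    IsSuperlinear (stageValue c K β v u) :=
  have hcost : IsSuperlinear fun ρ : X → ℝ => ρ ⬝ᵥ (fun x => c x u) :=
    .of_linearMap ((dotProductBilin ℝ ℝ).flip fun x => c x u)
  have hpush : IsSuperlinear fun ρ => v (ρ ᵥ* K u) :=
    hv.comp_linearMap (f := (K u).vecMulLinear) fun _ =>
      Matrix.nonneg_vecMul_of_mem_rowStochastic (hK u)
  hcost.add (hpush.const_mul hβ)

theorem IsSuperlinear.actionValue (hv : IsSuperlinear v) (hβ : 0 ≤ β)
    (a : Quantizer X M × ControlMap X M U) : IsSuperlinear (actionValue c K β v a) :=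
  .sum fun m _ => (hv.stageValue hK hβ _).comp_linearMap fun _ => cell_nonneg a.1 m

theorem IsSuperlinear.bellman [Finite U] [Nonempty M] [Nonempty U] (hv : IsSuperlinear v)
    (hβ : 0 ≤ β) :
    IsSuperlinear (bellman M c K β v) :=
  .iInf (hv.actionValue hK hβ)

theorem stageValue_mono (hβ : 0 ≤ β) (hvw : ∀ μ, 0 ≤ μ → v μ ≤ w μ) (u : U) {ρ : X → ℝ}
    (hρ : 0 ≤ ρ) : stageValue c K β v u ρ ≤ stageValue c K β w u ρ :=
  add_le_add_right (mul_le_mul_of_nonneg_left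
    (hvw _ (Matrix.nonneg_vecMul_of_mem_rowStochastic (hK u) hρ)) hβ) _

theorem actionValue_mono (hβ : 0 ≤ β) (hvw : ∀ μ, 0 ≤ μ → v μ ≤ w μ)
    (a : Quantizer X M × ControlMap X M U) {μ : X → ℝ} (hμ : 0 ≤ μ) :
    actionValue c K β v a μ ≤ actionValue c K β w a μ :=
  Finset.sum_le_sum fun m _ => stageValue_mono hK hβ hvw _ (cell_nonneg a.1 m hμ)

theorem abs_stageValue_le [Fintype U] (hβ : 0 ≤ β) {L : ℝ}
    (hv : ∀ μ, 0 ≤ μ → |v μ| ≤ L * (μ ⬝ᵥ 1)) (u : U) {ρ : X → ℝ} (hρ : 0 ≤ ρ) :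
    |stageValue c K β v u ρ| ≤ (‖c‖ + β * L) * (ρ ⬝ᵥ 1) := by
  have hmass : (ρ ᵥ* K u) ⬝ᵥ 1 = ρ ⬝ᵥ 1 := by
    rw [← Matrix.dotProduct_mulVec, (Matrix.mem_rowStochastic.1 (hK u)).2]
  have hnext := hv _ (Matrix.nonneg_vecMul_of_mem_rowStochastic (hK u) hρ)
  rw [hmass] at hnext
  calc |stageValue c K β v u ρ| ≤ |ρ ⬝ᵥ (fun x => c x u)| + β * |v (ρ ᵥ* K u)| :=
        (abs_add_le _ _).trans_eq (by rw [abs_mul, abs_of_nonneg hβ])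
    _ ≤ ‖c‖ * (ρ ⬝ᵥ 1) + β * (L * (ρ ⬝ᵥ 1)) :=
        add_le_add (abs_dotProduct_cost_le c u hρ) (mul_le_mul_of_nonneg_left hnext hβ)
    _ = (‖c‖ + β * L) * (ρ ⬝ᵥ 1) := by ring

theorem abs_actionValue_le [Fintype U] (hβ : 0 ≤ β) {L : ℝ}
    (hv : ∀ μ, 0 ≤ μ → |v μ| ≤ L * (μ ⬝ᵥ 1)) (a : Quantizer X M × ControlMap X M U)
    {μ : X → ℝ} (hμ : 0 ≤ μ) : |actionValue c K β v a μ| ≤ (‖c‖ + β * L) * (μ ⬝ᵥ 1) := by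
  rw [← sum_cell_dotProduct_one a.1 μ, Finset.mul_sum]
  exact (Finset.abs_sum_le_sum_abs _ _).trans
    (Finset.sum_le_sum fun m _ => abs_stageValue_le hK hβ hv _ (cell_nonneg a.1 m hμ))

theorem tendsto_stageValue {ι : Type*} {l : Filter ι} {f : ι → (X → ℝ) → ℝ}
    (hf : ∀ μ, 0 ≤ μ → Tendsto (f · μ) l (𝓝 (v μ))) (u : U) {ρ : X → ℝ} (hρ : 0 ≤ ρ) :
    Tendsto (fun i => stageValue c K β (f i) u ρ) l (𝓝 (stageValue c K β v u ρ)) :=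
  ((hf _ (Matrix.nonneg_vecMul_of_mem_rowStochastic (hK u) hρ)).const_mul β).const_add _

theorem tendsto_actionValue {ι : Type*} {l : Filter ι} {f : ι → (X → ℝ) → ℝ}
    (hf : ∀ μ, 0 ≤ μ → Tendsto (f · μ) l (𝓝 (v μ))) (a : Quantizer X M × ControlMap X M U)
    {μ : X → ℝ} (hμ : 0 ≤ μ) :
    Tendsto (fun i => actionValue c K β (f i) a μ) l (𝓝 (actionValue c K β v a μ)) :=
  tendsto_finsetSum _ fun m _ => tendsto_stageValue hK hf _ (cell_nonneg a.1 m hμ)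

theorem bellman_mono [Finite U] (hβ : 0 ≤ β) (hvw : ∀ μ, 0 ≤ μ → v μ ≤ w μ) {μ : X → ℝ}
    (hμ : 0 ≤ μ) : bellman M c K β v μ ≤ bellman M c K β w μ :=
  ciInf_mono (Set.finite_range _).bddBelow fun a => actionValue_mono hK hβ hvw a hμ

theorem abs_bellman_le [Fintype U] [Nonempty M] [Nonempty U] (hβ : 0 ≤ β) {L : ℝ}
    (hv : ∀ μ, 0 ≤ μ → |v μ| ≤ L * (μ ⬝ᵥ 1)) {μ : X → ℝ} (hμ : 0 ≤ μ) :
    |bellman M c K β v μ| ≤ (‖c‖ + β * L) * (μ ⬝ᵥ 1) := by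
  obtain ⟨a, ha⟩ := exists_eq_ciInf_of_finite
    (f := fun a : Quantizer X M × ControlMap X M U => actionValue c K β v a μ)
  rw [bellman, ← ha]
  exact abs_actionValue_le hK hβ hv a hμ

theorem tendsto_bellman [Finite U] [Nonempty M] [Nonempty U] {ι : Type*} {l : Filter ι}
    {f : ι → (X → ℝ) → ℝ} (hf : ∀ μ, 0 ≤ μ → Tendsto (f · μ) l (𝓝 (v μ))) {μ : X → ℝ}
    (hμ : 0 ≤ μ) :
    Tendsto (fun i => bellman M c K β (f i) μ) l (𝓝 (bellman M c K β v μ)) := by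
  have := Fintype.ofFinite (Quantizer X M × ControlMap X M U)
  simp only [bellman, ← Finset.inf'_univ_eq_ciInf]
  exact Tendsto.finset_inf'_nhds_apply _ fun a _ => tendsto_actionValue hK hf a hμ

/-- The weights `ν` need not be the cells of a quantizer: given the past symbols, an encoder may
still vary its quantizer with the past states. By concavity it gains nothing from this. -/
theorem bellman_sum_le [Finite U] [Nonempty M] (hv : IsSuperlinear v) (hβ : 0 ≤ β)
    {ν : M → X → ℝ} (hν : 0 ≤ ν) (u : M → U) :
    bellman M c K β v (∑ m, ν m) ≤ ∑ m, stageValue c K β v (u m) (ν m) := by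
  obtain ⟨Q, hQ⟩ := exists_quantizer_sum_le (F := fun m => stageValue c K β v (u m))
    (fun m => (hv.stageValue hK hβ (u m)).concaveOn) hν
  exact (ciInf_le (Set.finite_range _).bddBelow (Q, fun p : Quantizer X M × M => u p.2)).trans hQ

end RowStochastic

end Bellman

section ValueIteration

variable {X U : Type*} [Fintype X] [Fintype U] (M : Type*) [Fintype M]
  (c : X → U → ℝ) (K : U → Matrix X X ℝ) (β : ℝ)

/-- The bound `‖c‖ / (1 - β)`, in the supremum norm of `c`, on discounted costs per unit mass. -/
def valueBound : ℝ := ‖c‖ / (1 - β)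

/-- Value iteration. It starts from the constant lower bound on discounted costs, so that it is
increasing. -/
def valueIter (n : ℕ) : (X → ℝ) → ℝ :=
  (bellman M c K β)^[n] fun μ => -valueBound c β * (μ ⬝ᵥ 1)

/-- The optimal discounted cost as a function of the unnormalized weights of the initial state. -/
def valueFunction (μ : X → ℝ) : ℝ := ⨆ n, valueIter M c K β n μ

variable {c K β}

theorem norm_add_mul_valueBound (hβ₁ : β < 1) : ‖c‖ + β * valueBound c β = valueBound c β := by
  have : 1 - β ≠ 0 := (sub_pos.2 hβ₁).ne'
  rw [valueBound]
  field_simp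
  ring

theorem valueBound_nonneg (hβ₁ : β < 1) : 0 ≤ valueBound c β :=
  div_nonneg (norm_nonneg c) (sub_nonneg.2 hβ₁.le)

theorem valueIter_succ (n : ℕ) :
    valueIter M c K β (n + 1) = bellman M c K β (valueIter M c K β n) :=
  Function.iterate_succ_apply' _ n _

theorem measurable_valueIter (n : ℕ) : Measurable (valueIter M c K β n) := by
  induction n with
  | zero =>
    exact (Continuous.dotProduct continuous_id continuous_const).measurable.const_mul _
  | succ n ih => rw [valueIter_succ]; exact measurable_bellman ih

theorem measurable_valueFunction : Measurable (valueFunction M c K β) :=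
  .iSup (measurable_valueIter M)

variable [DecidableEq X] [Nonempty M] [Nonempty U]
  (hK : ∀ u, K u ∈ Matrix.rowStochastic ℝ X) (hβ₀ : 0 ≤ β)
include hK hβ₀

theorem isSuperlinear_valueIter (n : ℕ) : IsSuperlinear (valueIter M c K β n) := by
  induction n with
  | zero =>
    exact .of_linearMap (-valueBound c β • (dotProductBilin ℝ ℝ).flip (1 : X → ℝ))
  | succ n ih => rw [valueIter_succ]; exact ih.bellman hK hβ₀

variable (hβ₁ : β < 1)
include hβ₁

theorem abs_valueIter_le (n : ℕ) {μ : X → ℝ} (hμ : 0 ≤ μ) :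
    |valueIter M c K β n μ| ≤ valueBound c β * (μ ⬝ᵥ 1) := by
  induction n generalizing μ with
  | zero =>
    have hmass : 0 ≤ μ ⬝ᵥ 1 := dotProduct_nonneg_of_nonneg hμ zero_le_one
    simp [valueIter, abs_mul, abs_of_nonneg, valueBound_nonneg hβ₁, hmass]
  | succ n ih =>
    rw [valueIter_succ, ← norm_add_mul_valueBound hβ₁]
    exact abs_bellman_le hK hβ₀ (fun _ => ih) hμ

theorem valueIter_le_succ (n : ℕ) {μ : X → ℝ} (hμ : 0 ≤ μ) :
    valueIter M c K β n μ ≤ valueIter M c K β (n + 1) μ := by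
  induction n generalizing μ with
  | zero =>
    exact (neg_mul _ _).trans_le (abs_le.1 (abs_valueIter_le M hK hβ₀ hβ₁ 1 hμ)).1
  | succ n ih =>
    simp only [valueIter_succ M (n + 1), valueIter_succ M n] at ih ⊢
    exact bellman_mono hK hβ₀ (fun _ => ih) hμ

theorem tendsto_valueIter {μ : X → ℝ} (hμ : 0 ≤ μ) :
    Tendsto (valueIter M c K β · μ) atTop (𝓝 (valueFunction M c K β μ)) := by
  refine tendsto_atTop_ciSup (monotone_nat_of_le_succ fun n =>
    valueIter_le_succ M hK hβ₀ hβ₁ n hμ) ⟨valueBound c β * (μ ⬝ᵥ 1), ?_⟩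
  rintro _ ⟨n, rfl⟩
  exact (abs_le.1 (abs_valueIter_le M hK hβ₀ hβ₁ n hμ)).2

theorem isSuperlinear_valueFunction : IsSuperlinear (valueFunction M c K β) :=
  .of_tendsto (isSuperlinear_valueIter M hK hβ₀) fun _ => tendsto_valueIter M hK hβ₀ hβ₁

theorem abs_valueFunction_le {μ : X → ℝ} (hμ : 0 ≤ μ) :
    |valueFunction M c K β μ| ≤ valueBound c β * (μ ⬝ᵥ 1) :=
  le_of_tendsto' (tendsto_valueIter M hK hβ₀ hβ₁ hμ).abs
    fun n => abs_valueIter_le M hK hβ₀ hβ₁ n hμ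

theorem bellman_valueFunction {μ : X → ℝ} (hμ : 0 ≤ μ) :
    bellman M c K β (valueFunction M c K β) μ = valueFunction M c K β μ := by
  refine tendsto_nhds_unique
    (tendsto_bellman hK (fun _ => tendsto_valueIter M hK hβ₀ hβ₁) hμ) ?_
  simpa only [valueIter_succ] using
    (tendsto_add_atTop_iff_nat 1).2 (tendsto_valueIter M hK hβ₀ hβ₁ hμ)

end ValueIteration

section DiscountedSum

theorem le_of_tendsto_discountedSum {a V : ℕ → ℝ} {β L J : ℝ} (hβ₀ : 0 ≤ β) (hβ₁ : β < 1)
    (hV : ∀ t, |V t| ≤ L) (hstep : ∀ t, V t ≤ a t + β * V (t + 1))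
    (hJ : Tendsto (fun N => ∑ k ∈ Finset.range N, β ^ k * a k) atTop (𝓝 J)) : V 0 ≤ J := by
  have hunroll (N : ℕ) : V 0 ≤ ∑ k ∈ Finset.range N, β ^ k * a k + β ^ N * V N := by
    induction N with
    | zero => simp
    | succ N ih =>
      rw [Finset.sum_range_succ, pow_succ]
      linarith [mul_le_mul_of_nonneg_left (hstep N) (pow_nonneg hβ₀ N)]
  have htail : Tendsto (fun N => β ^ N * V N) atTop (𝓝 0) :=
    (tendsto_pow_atTop_nhds_zero_of_lt_one hβ₀ hβ₁).zero_mul_isBoundedUnder_le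
      (isBoundedUnder_of ⟨L, hV⟩)
  simpa only [add_zero] using ge_of_tendsto' (hJ.add htail) hunroll

theorem eq_of_tendsto_discountedSum {a V : ℕ → ℝ} {β L J : ℝ} (hβ₀ : 0 ≤ β) (hβ₁ : β < 1)
    (hV : ∀ t, |V t| ≤ L) (hstep : ∀ t, V t = a t + β * V (t + 1))
    (hJ : Tendsto (fun N => ∑ k ∈ Finset.range N, β ^ k * a k) atTop (𝓝 J)) : V 0 = J := by
  refine le_antisymm (le_of_tendsto_discountedSum hβ₀ hβ₁ hV (fun t => (hstep t).le) hJ)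
    (neg_le_neg_iff.1 (le_of_tendsto_discountedSum (a := -a) (V := -V) hβ₀ hβ₁
      (fun t => (abs_neg (V t)).trans_le (hV t)) (fun t => ?_) ?_))
  · simp only [Pi.neg_apply]
    linarith [hstep t]
  · simpa only [Pi.neg_apply, mul_neg, Finset.sum_neg_distrib] using hJ.neg

end DiscountedSum

theorem exists_fixedPoint_of_causal {ι : Type*} [LT ι] [WellFoundedLT ι] {α : ι → Type*}
    [∀ i, Nonempty (α i)] {Φ : (∀ i, α i) → ∀ i, α i}
    (hΦ : ∀ γ γ' i, (∀ j < i, γ j = γ' j) → Φ γ i = Φ γ' i) : ∃ γ, Φ γ = γ := by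
  classical
  let extend (i : ι) (γ : ∀ j, j < i → α j) (j : ι) : α j :=
    if h : j < i then γ j h else Classical.arbitrary _
  let γ := wellFounded_lt.fix fun i γ => Φ (extend i γ) i
  refine ⟨γ, funext fun i => ?_⟩
  rw [show γ i = Φ (extend i fun j _ => γ j) i from wellFounded_lt.fix_eq _ i]
  exact hΦ _ _ i fun j hj => by simp only [extend, dif_pos hj]

section Probability

variable {Ω Ω' α β γ : Type*} [MeasurableSpace Ω] [MeasurableSpace Ω']

theorem exists_measurable_argmin [Finite α] [Nonempty α] {F : α → Ω → ℝ}
    (hF : ∀ i, Measurable (F i)) :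
    ∃ g : Ω → α, Measurable[inferInstance, ⊤] g ∧ ∀ ω i, F (g ω) ω ≤ F i ω := by
  classical
  obtain ⟨e, he⟩ := exists_surjective_nat α
  have hex (ω : Ω) : ∃ k, ∀ i, F (e k) ω ≤ F i ω := by
    obtain ⟨i, hi⟩ := Finite.exists_min fun i => F i ω
    obtain ⟨k, rfl⟩ := he i
    exact ⟨k, hi⟩
  have hfind : Measurable fun ω => Nat.find (hex ω) := by
    refine measurable_find hex fun k => ?_
    simp only [Set.ofPred_forall]
    exact MeasurableSet.iInter fun i => measurableSet_le (hF _) (hF i)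
  exact ⟨fun ω => e (Nat.find (hex ω)), fun s _ => hfind (MeasurableSet.of_discrete (s := e ⁻¹' s)),
    fun ω => Nat.find_spec (hex ω)⟩

theorem indepFun_prodMk_fst_comp_snd [MeasurableSpace β] [MeasurableSpace γ] {μ : Measure Ω}
    [IsProbabilityMeasure μ] {ν : Measure Ω'} [IsProbabilityMeasure ν] {f : Ω' → β} {g : Ω' → γ}
    (hf : Measurable f) (hg : Measurable g) (hfg : IndepFun f g ν) :
    IndepFun (fun p : Ω × Ω' => (p.1, f p.2)) (fun p => g p.2) (μ.prod ν) := by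
  have hfst : MeasurePreserving (fun p : Ω × Ω' => (p.1, f p.2)) (μ.prod ν) (μ.prod (ν.map f)) :=
    (MeasurePreserving.id μ).prod (hf.measurePreserving ν)
  have hsnd : MeasurePreserving (fun p : Ω × Ω' => g p.2) (μ.prod ν) (ν.map g) :=
    (hg.measurePreserving ν).comp measurePreserving_snd
  have hpair : MeasurePreserving (fun w => (f w, g w)) ν ((ν.map f).prod (ν.map g)) :=
    ⟨hf.prodMk hg, hfg.map_prod_eq_prod_map_map hf.aemeasurable hg.aemeasurable⟩
  rw [indepFun_iff_map_prod_eq_prod_map_map hfst.aemeasurable hsnd.aemeasurable, hfst.map_eq,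
    hsnd.map_eq]
  exact (((measurePreserving_prodAssoc _ _ _).symm _).comp
    ((MeasurePreserving.id μ).prod hpair)).map_eq

variable {P : Measure Ω} [IsFiniteMeasure P] {φ : Ω → α}

theorem sum_measureReal_preimage_inter [Fintype α] (hφ : Measurable[_, ⊤] φ) (A : Set Ω) :
    ∑ a, P.real (φ ⁻¹' {a} ∩ A) = P.real A := by
  have hφ₁ (a : α) : MeasurableSet (φ ⁻¹' {a}) := hφ trivial
  simp only [← measureReal_restrict_apply (hφ₁ _)]
  rw [sum_measureReal_preimage_singleton _ fun a _ => hφ₁ a]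
  simp

theorem integrable_comp_of_finite [Finite α] (hφ : Measurable[_, ⊤] φ) (F : α → ℝ) :
    Integrable (fun ω => F (φ ω)) P := by
  let _ : MeasurableSpace α := ⊤
  exact (Integrable.of_finite (μ := P.map φ)).comp_measurable hφ

theorem integral_comp_of_fintype [Fintype α] (hφ : Measurable[_, ⊤] φ) (F : α → ℝ) :
    ∫ ω, F (φ ω) ∂P = ∑ a, P.real (φ ⁻¹' {a}) * F a := by
  let _ : MeasurableSpace α := ⊤
  rw [← integral_map hφ.aemeasurable Measurable.of_discrete.aestronglyMeasurable,
    integral_fintype .of_finite]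
  exact Finset.sum_congr rfl fun a _ => by
    rw [map_measureReal_apply hφ trivial, smul_eq_mul]

end Probability

section ProbabilityWeights

variable {X M U : Type*} [MeasurableSpace X]

/-- The probabilities `π {x}` as a vector of weights. -/
def weights (π : ProbabilityMeasure X) (x : X) : ℝ := (π : Measure X).real {x}

theorem weights_nonneg (π : ProbabilityMeasure X) : 0 ≤ weights π := fun _ => measureReal_nonneg

theorem measurable_weights [MeasurableSingletonClass X] :
    Measurable (weights : ProbabilityMeasure X → X → ℝ) :=
  measurable_pi_lambda _ fun x => ((Measure.measurable_coe (measurableSet_singleton x)).comp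
    measurable_subtype_coe).ennreal_toReal

theorem reducedCost_eq [Fintype X] [Fintype M] (c : X → U → ℝ) (π : ProbabilityMeasure X)
    (a : Quantizer X M × ControlMap X M U) :
    reducedCost c π a = ∑ m, cell a.1 m (weights π) ⬝ᵥ fun x => c x (a.2 (a.1, m)) := by
  classical
  simp only [dotProduct, cell_apply, ite_mul, zero_mul]
  rw [Finset.sum_comm]
  simp only [Finset.sum_ite_eq, Finset.mem_univ, if_true]
  rfl

theorem exists_measurable_actionValue_eq_bellman [Fintype X] [Fintype M] [Finite U]
    [Nonempty M] [Nonempty U] [MeasurableSingletonClass X] {c : X → U → ℝ}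
    {K : U → Matrix X X ℝ} {β : ℝ} {v : (X → ℝ) → ℝ} (hv : Measurable v) :
    ∃ g : ProbabilityMeasure X → Quantizer X M × ControlMap X M U, Measurable[inferInstance, ⊤] g ∧
      ∀ π, actionValue c K β v (g π) (weights π) = bellman M c K β v (weights π) := by
  obtain ⟨g, hg, hmin⟩ := exists_measurable_argmin
    fun a : Quantizer X M × ControlMap X M U =>
      (measurable_actionValue (c := c) (K := K) (β := β) hv a).comp measurable_weights
  exact ⟨g, hg, fun π => le_antisymm (le_ciInf (hmin π))
    (ciInf_le (Set.finite_range _).bddBelow (g π))⟩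

end ProbabilityWeights

section ClosedLoop

variable {X M U W : Type*} [MeasurableSpace X] [MeasurableSpace W]
  (S : Plant X U W) (γ : Policy X M U)

/-- The transition matrix `P(x_{t+1} = x' | x_t = x, u_t = u)` under the control `u`. -/
def Plant.transition (u : U) : Matrix X X ℝ := .of fun x x' => S.noise.real {w | S.f x u w = x'}

theorem Plant.transition_mem_rowStochastic [Fintype X] [DecidableEq X]
    [DiscreteMeasurableSpace X] (u : U) : S.transition u ∈ Matrix.rowStochastic ℝ X := by
  have := S.isProbabilityMeasure_noise
  refine Matrix.mem_rowStochastic_iff_sum.2 ⟨fun _ _ => measureReal_nonneg, fun x => ?_⟩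
  exact (sum_measureReal_preimage_singleton (μ := S.noise) (f := S.f x u) Finset.univ
    fun x' _ => S.measurable_f x u (measurableSet_singleton x')).trans (by simp)

/-- The channel symbol `q_t`. -/
def Plant.symbol (t : ℕ) (ω : X × (ℕ → W)) : M :=
  γ.enc t (S.hist γ ω t).1 (S.hist γ ω t).2.1

/-- The actions `u_{[0,t-1]}` as a function of the symbols `q_{[0,t-1]}`. -/
def Policy.controls : (t : ℕ) → (Fin t → M) → Fin t → U
  | 0 => fun _ => Fin.elim0
  | t + 1 => fun q =>
    Fin.snoc (Policy.controls t (Fin.init q)) (γ.ctrl t q (Policy.controls t (Fin.init q)))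

/-- The action `u_t` as a function of the symbols `q_{[0,t]}`. -/
def Policy.control (t : ℕ) (q : Fin (t + 1) → M) : U :=
  γ.ctrl t q (γ.controls t (Fin.init q))

theorem Plant.pastSymbols_succ (t : ℕ) (ω : X × (ℕ → W)) :
    S.pastSymbols γ (t + 1) ω = Fin.snoc (S.pastSymbols γ t ω) (S.symbol γ t ω) := rfl

theorem Plant.hist_controls (t : ℕ) (ω : X × (ℕ → W)) :
    (S.hist γ ω t).2.2 = γ.controls t (S.pastSymbols γ t ω) := by
  induction t with
  | zero => rfl
  | succ t ih =>
    simp only [Policy.controls, S.pastSymbols_succ, Fin.init_snoc, ← ih]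
    rfl

theorem Plant.action_eq (t : ℕ) (ω : X × (ℕ → W)) :
    S.action γ t ω = γ.control t (Fin.snoc (S.pastSymbols γ t ω) (S.symbol γ t ω)) := by
  simp only [Plant.action, Plant.hist_controls, Policy.controls, Fin.snoc_last]
  rfl

theorem Plant.state_succ (t : ℕ) (ω : X × (ℕ → W)) :
    S.state γ (t + 1) ω = S.f (S.state γ t ω) (S.action γ t ω) (ω.2 t) := by
  simp only [Plant.state, Plant.action, Plant.hist, Plant.step, Fin.snoc_last]

theorem Plant.hist_congr_policy {γ γ' : Policy X M U} {t : ℕ}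
    (he : ∀ s < t, γ.enc s = γ'.enc s)
    (hc : ∀ s < t, γ.ctrl s = γ'.ctrl s) (ω : X × (ℕ → W)) : S.hist γ ω t = S.hist γ' ω t := by
  induction t with
  | zero => rfl
  | succ t ih =>
    simp only [Plant.hist, Plant.step, he t t.lt_succ_self, hc t t.lt_succ_self,
      ih (fun s hs => he s (hs.trans t.lt_succ_self)) fun s hs => hc s (hs.trans t.lt_succ_self)]

variable [DiscreteMeasurableSpace X]

theorem Plant.measurable_step (t : ℕ) (h : (Fin (t + 1) → X) × (Fin t → M) × (Fin t → U)) :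
    Measurable[_, ⊤] (S.step γ t h) := by
  let _ : MeasurableSpace ((Fin (t + 2) → X) × (Fin (t + 1) → M) × (Fin (t + 1) → U)) := ⊤
  let q : Fin (t + 1) → M := Fin.snoc h.2.1 (γ.enc t h.1 h.2.1)
  let u : U := γ.ctrl t q h.2.2
  let next (x : X) : (Fin (t + 2) → X) × (Fin (t + 1) → M) × (Fin (t + 1) → U) :=
    (Fin.snoc h.1 x, q, Fin.snoc h.2.2 u)
  exact (Measurable.of_discrete (f := next)).comp (S.measurable_f (h.1 (Fin.last t)) u)

section Finite

variable [Finite X] [Finite M] [Finite U]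

theorem Plant.measurable_hist_of_measurable_coord {m : MeasurableSpace (X × (ℕ → W))} {t : ℕ}
    (hfst : Measurable[m] fun ω : X × (ℕ → W) => ω.1)
    (hsnd : ∀ i < t, Measurable[m] fun ω : X × (ℕ → W) => ω.2 i) :
    Measurable[m, ⊤] fun ω => S.hist γ ω t := by
  induction t with
  | zero =>
    let _ : MeasurableSpace ((Fin 1 → X) × (Fin 0 → M) × (Fin 0 → U)) := ⊤
    exact (Measurable.of_discrete (f := fun x => (fun _ => x, Fin.elim0, Fin.elim0))).comp hfst
  | succ t ih =>
    let _ : MeasurableSpace ((Fin (t + 1) → X) × (Fin t → M) × (Fin t → U)) := ⊤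
    let _ : MeasurableSpace ((Fin (t + 2) → X) × (Fin (t + 1) → M) × (Fin (t + 1) → U)) := ⊤
    exact (measurable_from_prod_countable_right
      (f := fun p => S.step γ t p.1 p.2) (S.measurable_step γ t)).comp
      ((ih fun i hi => hsnd i (hi.trans t.lt_succ_self)).prodMk (hsnd t t.lt_succ_self))

theorem Plant.measurable_hist (t : ℕ) : Measurable[_, ⊤] fun ω => S.hist γ ω t :=
  S.measurable_hist_of_measurable_coord γ measurable_fst
    fun i _ => (measurable_pi_apply i).comp measurable_snd

theorem Plant.indep_hist_noise (π₀ : ProbabilityMeasure X) (t : ℕ) :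
    Indep (MeasurableSpace.comap (fun ω => S.hist γ ω t) ⊤)
      (MeasurableSpace.comap (fun ω => ω.2 t) inferInstance) (S.prob π₀) := by
  have := S.isProbabilityMeasure_noise
  let past (w : ℕ → W) (i : Finset.range t) : W := w i
  have hpast : Measurable past := by fun_prop
  have hnoise : IndepFun past (fun w => w t) (Measure.infinitePi fun _ => S.noise) :=
    ((iIndepFun_infinitePi (X := fun (_ : ℕ) w => w) fun _ => measurable_id).indepFun_finset
      (Finset.range t) {t} (by simp) fun i => measurable_pi_apply i).comp
      measurable_id (measurable_pi_apply ⟨t, Finset.mem_singleton_self t⟩)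
  have hindep := indepFun_prodMk_fst_comp_snd (μ := (π₀ : Measure X)) hpast
    (measurable_pi_apply t) hnoise
  have hprefix := comap_measurable (m := inferInstance)
    fun ω : X × (ℕ → W) => (ω.1, past ω.2)
  refine indep_of_indep_of_le_left hindep (Measurable.comap_le ?_)
  exact S.measurable_hist_of_measurable_coord γ hprefix.fst fun i hi =>
    (measurable_pi_apply (⟨i, Finset.mem_range.2 hi⟩ : Finset.range t)).comp hprefix.snd

theorem Plant.measureReal_hist_inter_noise (π₀ : ProbabilityMeasure X) (t : ℕ)
    (A : Set ((Fin (t + 1) → X) × (Fin t → M) × (Fin t → U))) {B : Set W}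
    (hB : MeasurableSet B) :
    (S.prob π₀).real ({ω | S.hist γ ω t ∈ A} ∩ {ω | ω.2 t ∈ B})
      = (S.prob π₀).real {ω | S.hist γ ω t ∈ A} * S.noise.real B := by
  have := S.isProbabilityMeasure_noise
  have hlaw : MeasurePreserving (fun ω : X × (ℕ → W) => ω.2 t) (S.prob π₀) S.noise :=
    (measurePreserving_eval_infinitePi (fun _ => S.noise) t).comp measurePreserving_snd
  rw [← hlaw.measureReal_preimage hB.nullMeasurableSet, measureReal_def, measureReal_def,
    measureReal_def, ← ENNReal.toReal_mul]
  exact congrArg ENNReal.toReal ((Indep_iff _ _ _).1 (S.indep_hist_noise γ π₀ t) _ _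
    ⟨A, trivial, rfl⟩ ⟨B, hB, rfl⟩)

end Finite

end ClosedLoop

section Weights

variable {X M U W : Type*} [MeasurableSpace X] [MeasurableSpace W]

/-- The weights `P(q_{[0,t-1]} = q, x_t = x)` of the state on the event `q_{[0,t-1]} = q`. They are
the unnormalized predictor. -/
def Plant.stateWeight (S : Plant X U W) (π₀ : ProbabilityMeasure X) (γ : Policy X M U) (t : ℕ)
    (q : Fin t → M) (x : X) : ℝ :=
  (S.prob π₀).real {ω | S.state γ t ω = x ∧ S.pastSymbols γ t ω = q}

/-- The weights `P(q_{[0,t-1]} = q, q_t = m, x_t = x)` of the state on the event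
`q_{[0,t]} = (q, m)`, on which the control `u_t` is constant. -/
def Plant.jointWeight (S : Plant X U W) (π₀ : ProbabilityMeasure X) (γ : Policy X M U) (t : ℕ)
    (q : Fin t → M) (m : M) (x : X) : ℝ :=
  (S.prob π₀).real {ω | S.symbol γ t ω = m ∧ S.state γ t ω = x ∧ S.pastSymbols γ t ω = q}

/-- The expected cost `E[c(x_t, u_t)]`. -/
def Plant.stageCost (S : Plant X U W) (c : X → U → ℝ) (π₀ : ProbabilityMeasure X)
    (γ : Policy X M U) (t : ℕ) : ℝ :=
  ∫ ω, c (S.state γ t ω) (S.action γ t ω) ∂S.prob π₀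

variable (S : Plant X U W) (c : X → U → ℝ) (π₀ : ProbabilityMeasure X) (γ : Policy X M U)

theorem Plant.stateWeight_nonneg (t : ℕ) (q : Fin t → M) : 0 ≤ S.stateWeight π₀ γ t q :=
  fun _ => measureReal_nonneg

theorem Plant.jointWeight_nonneg (t : ℕ) (q : Fin t → M) : 0 ≤ S.jointWeight π₀ γ t q :=
  fun _ _ => measureReal_nonneg

theorem Plant.stateWeight_zero (q : Fin 0 → M) : S.stateWeight π₀ γ 0 q = weights π₀ := by
  have := S.isProbabilityMeasure_noise
  ext x
  have hevent : {ω : X × (ℕ → W) | S.state γ 0 ω = x ∧ S.pastSymbols γ 0 ω = q} =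
      {x} ×ˢ Set.univ := by
    ext ω
    simp [Plant.state, Plant.hist, eq_iff_true_of_subsingleton]
  rw [Plant.stateWeight, hevent, Plant.prob, measureReal_prod_prod]
  simp [weights]

theorem Plant.abs_stageCost_le [Fintype X] [Fintype U] (t : ℕ) :
    |S.stageCost c π₀ γ t| ≤ ‖c‖ := by
  simpa [Plant.stageCost] using norm_integral_le_of_norm_le_const (μ := S.prob π₀)
    (f := fun ω => c (S.state γ t ω) (S.action γ t ω)) (C := ‖c‖)
    (Eventually.of_forall fun ω => abs_cost_le c _ _)

theorem sum_snoc [Fintype M] {t : ℕ} (F : (Fin (t + 1) → M) → ℝ) :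
    ∑ q, F q = ∑ q : Fin t → M, ∑ m, F (Fin.snoc q m) := by
  rw [← (Fin.snocEquiv fun _ : Fin (t + 1) => M).sum_comp, Fintype.sum_prod_type, Finset.sum_comm]
  rfl

variable [DiscreteMeasurableSpace X]

section Finite

variable [Finite X] [Finite M] [Finite U]

theorem Plant.measurable_comp_hist {α : Type*} (t : ℕ)
    (F : (Fin (t + 1) → X) × (Fin t → M) × (Fin t → U) → α) :
    Measurable[_, ⊤] fun ω => F (S.hist γ ω t) := by
  let _ : MeasurableSpace α := ⊤
  exact (measurable_from_top (f := F)).comp (S.measurable_hist γ t)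

theorem Plant.integrable_cost (t : ℕ) :
    Integrable (fun ω => c (S.state γ t ω) (S.action γ t ω)) (S.prob π₀) := by
  simp only [S.action_eq]
  exact integrable_comp_of_finite (S.measurable_hist γ t) fun h =>
    c (h.1 (Fin.last t)) (γ.control t (Fin.snoc h.2.1 (γ.enc t h.1 h.2.1)))

theorem Plant.finiteCost_eq (β : ℝ) (N : ℕ) :
    S.finiteCost c β π₀ γ N = ∑ k ∈ Finset.range N, β ^ k * S.stageCost c π₀ γ k := by
  rw [Plant.finiteCost, integral_finsetSum _ fun k _ => (S.integrable_cost c π₀ γ k).const_mul _]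
  simp only [integral_const_mul, Plant.stageCost]

end Finite

theorem Plant.tendsto_finiteCost [Finite X] [Finite M] [Finite U] {β : ℝ} (hβ₀ : 0 ≤ β)
    (hβ₁ : β < 1) :
    Tendsto (S.finiteCost c β π₀ γ) atTop (𝓝 (S.discountedCost c β π₀ γ)) := by
  have := Fintype.ofFinite X
  have := Fintype.ofFinite U
  have hsum : Summable fun k => β ^ k * S.stageCost c π₀ γ k := by
    refine .of_norm_bounded ((summable_geometric_of_lt_one hβ₀ hβ₁).mul_right ‖c‖) fun k => ?_
    rw [norm_mul, norm_pow, Real.norm_of_nonneg hβ₀]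
    exact mul_le_mul_of_nonneg_left (S.abs_stageCost_le c π₀ γ k) (pow_nonneg hβ₀ k)
  exact tendsto_nhds_limUnder ⟨_, hsum.hasSum.tendsto_sum_nat.congr fun N =>
    (S.finiteCost_eq c π₀ γ β N).symm⟩

theorem Plant.sum_jointWeight [Finite X] [Fintype M] [Finite U] (t : ℕ) (q : Fin t → M) :
    ∑ m, S.jointWeight π₀ γ t q m = S.stateWeight π₀ γ t q := by
  ext x
  rw [Finset.sum_apply]
  exact sum_measureReal_preimage_inter (φ := S.symbol γ t)
    (S.measurable_comp_hist γ t fun h => γ.enc t h.1 h.2.1) _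

variable [Fintype X]

theorem Plant.stateWeight_dotProduct_one [Finite M] [Finite U] (t : ℕ) (q : Fin t → M) :
    S.stateWeight π₀ γ t q ⬝ᵥ 1 = (S.prob π₀).real {ω | S.pastSymbols γ t ω = q} := by
  rw [dotProduct_one]
  exact sum_measureReal_preimage_inter (φ := S.state γ t)
    (S.measurable_comp_hist γ t fun h => h.1 (Fin.last t)) _

theorem Plant.sum_stateWeight_dotProduct_one [Fintype M] [Finite U] (t : ℕ) :
    ∑ q, S.stateWeight π₀ γ t q ⬝ᵥ 1 = 1 := by
  simp only [S.stateWeight_dotProduct_one]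
  exact (sum_measureReal_preimage_singleton (μ := S.prob π₀) (f := S.pastSymbols γ t) Finset.univ
    fun q _ => S.measurable_comp_hist γ t (fun h => h.2.1) trivial).trans (by simp)

theorem Plant.stateWeight_succ [Finite M] [Finite U] (t : ℕ) (q : Fin t → M) (m : M) :
    S.stateWeight π₀ γ (t + 1) (Fin.snoc q m) =
      S.jointWeight π₀ γ t q m ᵥ* S.transition (γ.control t (Fin.snoc q m)) := by
  ext x'
  rw [Plant.stateWeight, ← sum_measureReal_preimage_inter (φ := S.state γ t)
    (S.measurable_comp_hist γ t fun h => h.1 (Fin.last t)), Matrix.vecMul, dotProduct]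
  refine Finset.sum_congr rfl fun x _ => ?_
  have hindep := S.measureReal_hist_inter_noise γ π₀ t
    {h | γ.enc t h.1 h.2.1 = m ∧ h.1 (Fin.last t) = x ∧ h.2.1 = q}
    (S.measurable_f x (γ.control t (Fin.snoc q m)) (measurableSet_singleton x'))
  refine Eq.trans (congrArg _ (Set.ext fun ω => ?_)) hindep
  change S.state γ t ω = x ∧ S.state γ (t + 1) ω = x' ∧
      S.pastSymbols γ (t + 1) ω = Fin.snoc q m ↔
    (S.symbol γ t ω = m ∧ S.state γ t ω = x ∧ S.pastSymbols γ t ω = q) ∧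
      S.f x (γ.control t (Fin.snoc q m)) (ω.2 t) = x'
  rw [S.state_succ, S.action_eq, S.pastSymbols_succ, Fin.snoc_inj]
  constructor
  · rintro ⟨rfl, hf, rfl, rfl⟩
    exact ⟨⟨rfl, rfl, rfl⟩, hf⟩
  · rintro ⟨⟨rfl, rfl, rfl⟩, hf⟩
    exact ⟨rfl, hf, rfl, rfl⟩

variable [Fintype M]

theorem Plant.stageCost_eq [Finite U] (t : ℕ) :
    S.stageCost c π₀ γ t = ∑ q, ∑ m, S.jointWeight π₀ γ t q m ⬝ᵥ
      fun x => c x (γ.control t (Fin.snoc q m)) := by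
  have hcost := integral_comp_of_fintype (P := S.prob π₀)
    (φ := fun ω => (S.pastSymbols γ t ω, S.symbol γ t ω, S.state γ t ω))
    (S.measurable_comp_hist γ t fun h => (h.2.1, γ.enc t h.1 h.2.1, h.1 (Fin.last t)))
    fun p => c p.2.2 (γ.control t (Fin.snoc p.1 p.2.1))
  simp only [Plant.stageCost, S.action_eq, hcost, Fintype.sum_prod_type, dotProduct]
  refine Finset.sum_congr rfl fun q _ => Finset.sum_congr rfl fun m _ =>
    Finset.sum_congr rfl fun x _ => congrArg (fun A => (S.prob π₀).real A * _) (Set.ext fun ω => ?_)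
  simp only [Set.mem_preimage, Set.mem_singleton_iff, Prod.mk.injEq, Set.mem_ofPred_eq]
  tauto

theorem Plant.stageCost_add_mul_sum [Finite U] (β : ℝ) (v : (X → ℝ) → ℝ) (t : ℕ) :
    S.stageCost c π₀ γ t + β * ∑ q, v (S.stateWeight π₀ γ (t + 1) q) =
      ∑ q, ∑ m, stageValue c S.transition β v (γ.control t (Fin.snoc q m))
        (S.jointWeight π₀ γ t q m) := by
  simp only [S.stageCost_eq, sum_snoc, S.stateWeight_succ, stageValue, Finset.mul_sum,
    Finset.sum_add_distrib]

theorem Plant.abs_sum_stateWeight_le [Finite U] {v : (X → ℝ) → ℝ} {L : ℝ}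
    (hv : ∀ μ, 0 ≤ μ → |v μ| ≤ L * (μ ⬝ᵥ 1)) (t : ℕ) :
    |∑ q, v (S.stateWeight π₀ γ t q)| ≤ L :=
  calc |∑ q, v (S.stateWeight π₀ γ t q)| ≤ ∑ q, |v (S.stateWeight π₀ γ t q)| :=
        Finset.abs_sum_le_sum_abs _ _
    _ ≤ ∑ q, L * (S.stateWeight π₀ γ t q ⬝ᵥ 1) :=
        Finset.sum_le_sum fun q _ => hv _ (S.stateWeight_nonneg π₀ γ t q)
    _ = L := by rw [← Finset.mul_sum, S.sum_stateWeight_dotProduct_one, mul_one]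

variable [Fintype U] [Nonempty M] [Nonempty U] {β : ℝ} (hβ₀ : 0 ≤ β) (hβ₁ : β < 1)
include hβ₀ hβ₁

theorem Plant.valueFunction_le_discountedCost :
    valueFunction M c S.transition β (weights π₀) ≤ S.discountedCost c β π₀ γ := by
  classical
  have hK := S.transition_mem_rowStochastic
  let V (t : ℕ) : ℝ := ∑ q, valueFunction M c S.transition β (S.stateWeight π₀ γ t q)
  have hV (t : ℕ) : |V t| ≤ valueBound c β :=
    S.abs_sum_stateWeight_le π₀ γ (fun _ => abs_valueFunction_le M hK hβ₀ hβ₁) t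
  have hstep (t : ℕ) : V t ≤ S.stageCost c π₀ γ t + β * V (t + 1) := by
    rw [S.stageCost_add_mul_sum]
    refine Finset.sum_le_sum fun q _ => ?_
    rw [← bellman_valueFunction M hK hβ₀ hβ₁ (S.stateWeight_nonneg π₀ γ t q), ← S.sum_jointWeight]
    exact bellman_sum_le hK (isSuperlinear_valueFunction M hK hβ₀ hβ₁) hβ₀
      (S.jointWeight_nonneg π₀ γ t q) fun m => γ.control t (Fin.snoc q m)
  have hlim := (S.tendsto_finiteCost c π₀ γ hβ₀ hβ₁).congr (S.finiteCost_eq c π₀ γ β)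
  simpa only [V, Fintype.sum_unique, S.stateWeight_zero] using
    le_of_tendsto_discountedSum hβ₀ hβ₁ hV hstep hlim

end Weights

section Predictor

variable {X M U W : Type*} [MeasurableSpace X] [DiscreteMeasurableSpace X] [MeasurableSpace W]
  [Finite X] [Finite M] [Finite U] (S : Plant X U W) (π₀ : ProbabilityMeasure X)

theorem Plant.coe_predictor_of_ne_zero (γ : Policy X M U) {t : ℕ} {q : Fin t → M}
    (hq : S.prob π₀ {ω | S.pastSymbols γ t ω = q} ≠ 0) :
    (S.predictor π₀ γ t q : Measure X) =
      (cond (S.prob π₀) {ω | S.pastSymbols γ t ω = q}).map (S.state γ t) :=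
  congrArg Subtype.val (dif_pos hq)

theorem Plant.predictor_of_eq_zero (γ : Policy X M U) {t : ℕ} {q : Fin t → M}
    (hq : S.prob π₀ {ω | S.pastSymbols γ t ω = q} = 0) : S.predictor π₀ γ t q = π₀ :=
  dif_neg (not_not_intro hq)

theorem Plant.stateWeight_eq_smul_predictor (γ : Policy X M U) (t : ℕ) (q : Fin t → M) :
    S.stateWeight π₀ γ t q = (S.prob π₀).real {ω | S.pastSymbols γ t ω = q} •
      weights (S.predictor π₀ γ t q) := by
  have hpast : MeasurableSet (S.pastSymbols γ t ⁻¹' {q}) :=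
    S.measurable_comp_hist γ t (fun h => h.2.1) trivial
  have hinter (x : X) : {ω | S.state γ t ω = x ∧ S.pastSymbols γ t ω = q} =
      {ω | S.pastSymbols γ t ω = q} ∩ S.state γ t ⁻¹' {x} := Set.inter_comm _ _
  ext x
  rw [Plant.stateWeight, hinter, Pi.smul_apply, smul_eq_mul, weights]
  by_cases hq : S.prob π₀ {ω | S.pastSymbols γ t ω = q} = 0
  · rw [measureReal_def, measure_inter_null_of_null_left _ hq, measureReal_def, hq]
    simp
  · rw [S.coe_predictor_of_ne_zero π₀ γ hq,
      map_measureReal_apply (S.measurable_state γ t) (measurableSet_singleton x), mul_comm,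
      measureReal_def, measureReal_def, measureReal_def, ← ENNReal.toReal_mul]
    exact congrArg ENNReal.toReal (cond_mul_eq_inter hpast _ _).symm

theorem Plant.predictor_congr_policy {γ γ' : Policy X M U} {t : ℕ}
    (he : ∀ s < t, γ.enc s = γ'.enc s) (hc : ∀ s < t, γ.ctrl s = γ'.ctrl s) :
    S.predictor π₀ γ t = S.predictor π₀ γ' t := by
  have hhist := S.hist_congr_policy he hc
  have hpast : S.pastSymbols γ t = S.pastSymbols γ' t := funext fun ω => congrArg (·.2.1) (hhist ω)
  have hstate : S.state γ t = S.state γ' t :=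
    funext fun ω => congrArg (·.1 (Fin.last t)) (hhist ω)
  ext1 q
  by_cases hq : S.prob π₀ {ω | S.pastSymbols γ' t ω = q} = 0
  · rw [S.predictor_of_eq_zero π₀ γ' hq, S.predictor_of_eq_zero π₀ γ (by rwa [hpast])]
  · refine Subtype.ext ((S.coe_predictor_of_ne_zero π₀ γ (by rwa [hpast])).trans ?_)
    rw [hpast, hstate]
    exact (S.coe_predictor_of_ne_zero π₀ γ' hq).symm

/-- The structure refers to the predictors under `γ` itself. This is not circular because the
predictor at time `t` depends only on the maps of `γ` before time `t`. -/
theorem Plant.exists_hasControlledPredictorStructure [Nonempty M] [Nonempty U]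
    (g : ℕ → ProbabilityMeasure X → Quantizer X M × ControlMap X M U) :
    ∃ γ : Policy X M U, S.HasControlledPredictorStructure π₀ γ g := by
  let α (t : ℕ) := ((Fin (t + 1) → X) → (Fin t → M) → M) × ((Fin (t + 1) → M) → (Fin t → U) → U)
  let policy (p : ∀ t, α t) : Policy X M U := ⟨fun t => (p t).1, fun t => (p t).2⟩
  let greedy (t : ℕ) (predict : (Fin t → M) → ProbabilityMeasure X) : α t :=
    (fun x q => (g t (predict q)).1 (x (Fin.last t)),
      fun q _ => (g t (predict (Fin.init q))).2 ((g t (predict (Fin.init q))).1, q (Fin.last t)))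
  obtain ⟨p, hp⟩ := exists_fixedPoint_of_causal (α := α)
    (Φ := fun p t => greedy t (S.predictor π₀ (policy p) t)) fun p p' t hpp' =>
      congrArg (greedy t) (S.predictor_congr_policy π₀ (fun s hs => congrArg Prod.fst (hpp' s hs))
        fun s hs => congrArg Prod.snd (hpp' s hs))
  have hp' (t : ℕ) : greedy t (S.predictor π₀ (policy p) t) = p t := congrFun hp t
  exact ⟨policy p, fun t x q => (congrFun₂ (congrArg Prod.fst (hp' t)) x q).symm,
    fun t q u => (congrFun₂ (congrArg Prod.snd (hp' t)) q u).symm⟩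

end Predictor

section ControlledPredictor

variable {X M U W : Type*} [MeasurableSpace X] [DiscreteMeasurableSpace X] [MeasurableSpace W]
  {S : Plant X U W} {π₀ : ProbabilityMeasure X} {γ : Policy X M U}
  {g : ℕ → ProbabilityMeasure X → Quantizer X M × ControlMap X M U}

theorem Plant.HasControlledPredictorStructure.control_eq [Finite X] [Finite M] [Finite U]
    (h : S.HasControlledPredictorStructure π₀ γ g) (t : ℕ) (q : Fin t → M) (m : M) :
    γ.control t (Fin.snoc q m) = (g t (S.predictor π₀ γ t q)).2
      ((g t (S.predictor π₀ γ t q)).1, m) := by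
  rw [Policy.control, h.2, Fin.init_snoc, Fin.snoc_last]

theorem Plant.HasControlledPredictorStructure.jointWeight_eq [Finite X] [Finite M] [Finite U]
    (h : S.HasControlledPredictorStructure π₀ γ g) (t : ℕ) (q : Fin t → M) (m : M) :
    S.jointWeight π₀ γ t q m =
      cell (g t (S.predictor π₀ γ t q)).1 m (S.stateWeight π₀ γ t q) := by
  classical
  have hsymbol (ω) : S.symbol γ t ω =
      (g t (S.predictor π₀ γ t (S.pastSymbols γ t ω))).1 (S.state γ t ω) := h.1 _ _ _
  ext x
  rw [cell_apply]
  split_ifs with hx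
  · refine congrArg (S.prob π₀).real (Set.ext fun ω => and_iff_right_of_imp ?_)
    rintro ⟨rfl, rfl⟩
    rw [hsymbol, hx]
  · rw [Plant.jointWeight, ← measureReal_empty (μ := S.prob π₀)]
    refine congrArg (S.prob π₀).real (Set.eq_empty_of_forall_notMem ?_)
    rintro ω ⟨hm, rfl, rfl⟩
    exact hx ((hsymbol ω).symm.trans hm)

variable [Fintype X]

theorem Plant.HasControlledPredictorStructure.stageCost_eq [Finite M] [Finite U]
    (h : S.HasControlledPredictorStructure π₀ γ g) (c : X → U → ℝ) (t : ℕ) :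
    S.stageCost c π₀ γ t = ∫ ω, reducedCost c (S.predictor π₀ γ t (S.pastSymbols γ t ω))
      (g t (S.predictor π₀ γ t (S.pastSymbols γ t ω))) ∂S.prob π₀ := by
  have := Fintype.ofFinite M
  rw [S.stageCost_eq, integral_comp_of_fintype (φ := S.pastSymbols γ t)
    (S.measurable_comp_hist γ t fun h => h.2.1)
    fun q => reducedCost c (S.predictor π₀ γ t q) (g t (S.predictor π₀ γ t q))]
  refine Finset.sum_congr rfl fun q _ => ?_
  simp only [h.jointWeight_eq, h.control_eq, S.stateWeight_eq_smul_predictor, map_smul,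
    smul_dotProduct, ← Finset.smul_sum, ← reducedCost_eq]
  rfl

theorem Plant.HasControlledPredictorStructure.finiteReducedCost_eq [Finite M] [Finite U]
    (h : S.HasControlledPredictorStructure π₀ γ g) (c : X → U → ℝ) (β : ℝ) :
    S.finiteReducedCost c β π₀ γ g = S.finiteCost c β π₀ γ := by
  ext N
  rw [S.finiteCost_eq, Plant.finiteReducedCost, integral_finsetSum]
  · simp only [integral_const_mul, h.stageCost_eq]
  · intro k _
    exact (integrable_comp_of_finite (φ := S.pastSymbols γ k)
      (S.measurable_comp_hist γ k fun h => h.2.1)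
      fun q => reducedCost c (S.predictor π₀ γ k q) (g k (S.predictor π₀ γ k q))).const_mul _

variable [Fintype M] [Fintype U] [Nonempty M] [Nonempty U] {c : X → U → ℝ} {β : ℝ}

theorem Plant.HasControlledPredictorStructure.discountedCost_eq_valueFunction
    (h : S.HasControlledPredictorStructure π₀ γ g) (hβ₀ : 0 ≤ β) (hβ₁ : β < 1)
    (hg : ∀ t π, actionValue c S.transition β (valueFunction M c S.transition β) (g t π)
      (weights π) = valueFunction M c S.transition β (weights π)) :
    S.discountedCost c β π₀ γ = valueFunction M c S.transition β (weights π₀) := by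
  classical
  have hK := S.transition_mem_rowStochastic
  have hsuper := isSuperlinear_valueFunction (c := c) M hK hβ₀ hβ₁
  let V (t : ℕ) : ℝ := ∑ q, valueFunction M c S.transition β (S.stateWeight π₀ γ t q)
  have hV (t : ℕ) : |V t| ≤ valueBound c β :=
    S.abs_sum_stateWeight_le π₀ γ (fun _ => abs_valueFunction_le M hK hβ₀ hβ₁) t
  have hstep (t : ℕ) : V t = S.stageCost c π₀ γ t + β * V (t + 1) := by
    rw [S.stageCost_add_mul_sum]
    refine Finset.sum_congr rfl fun q _ => ?_
    have hscale := (hsuper.actionValue (c := c) hK hβ₀ (g t (S.predictor π₀ γ t q))).map_smul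
      (measureReal_nonneg (μ := S.prob π₀) (s := {ω | S.pastSymbols γ t ω = q}))
      (weights_nonneg (S.predictor π₀ γ t q))
    rw [hg, ← hsuper.map_smul measureReal_nonneg (weights_nonneg _),
      ← S.stateWeight_eq_smul_predictor] at hscale
    simp only [← hscale, actionValue, h.jointWeight_eq, h.control_eq]
  have hlim := (S.tendsto_finiteCost c π₀ γ hβ₀ hβ₁).congr (S.finiteCost_eq c π₀ γ β)
  simpa only [V, Fintype.sum_unique, S.stateWeight_zero] using
    (eq_of_tendsto_discountedSum hβ₀ hβ₁ hV hstep hlim).symm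

end ControlledPredictor

end CodingControl

end

theorem mainTheorem1 {X M U W : Type*} [Fintype X] [MeasurableSpace X]
    [DiscreteMeasurableSpace X] [Finite M] [Nonempty M] [Finite U] [Nonempty U]
    [MeasurableSpace W] (S : CodingControl.Plant X U W) (c : X → U → ℝ)
    (β : ℝ) (hβ₀ : 0 < β) (hβ₁ : β < 1) :
    ∃ g : ProbabilityMeasure X →
        CodingControl.Quantizer X M × CodingControl.ControlMap X M U,
      -- the finite set of pairs `(Q, η)` carries the discrete σ-algebra
      Measurable[inferInstance, ⊤] g ∧
      ∀ π₀ : ProbabilityMeasure X,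
        -- the limit defining the discounted cost exists for every admissible policy
        (∀ γ' : CodingControl.Policy X M U,
          Tendsto (S.finiteCost c β π₀ γ') atTop (𝓝 (S.discountedCost c β π₀ γ'))) ∧
        ∃ γ : CodingControl.Policy X M U,
          S.HasControlledPredictorStructure π₀ γ (fun _ => g) ∧
          IsLeast (Set.range fun γ' : CodingControl.Policy X M U =>
            S.discountedCost c β π₀ γ') (S.discountedCost c β π₀ γ) ∧
          Tendsto (S.finiteReducedCost c β π₀ γ (fun _ => g)) atTop
            (𝓝 (S.discountedCost c β π₀ γ)) := by
  classical
  have := Fintype.ofFinite M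
  have := Fintype.ofFinite U
  have hK := S.transition_mem_rowStochastic
  obtain ⟨g, hg, hgreedy⟩ :=
    CodingControl.exists_measurable_actionValue_eq_bellman (M := M) (c := c) (β := β)
      (K := S.transition) (CodingControl.measurable_valueFunction M (c := c) (β := β))
  have hopt (π : ProbabilityMeasure X) := (hgreedy π).trans
    (CodingControl.bellman_valueFunction M hK hβ₀.le hβ₁ (CodingControl.weights_nonneg π))
  refine ⟨g, hg, fun π₀ => ⟨fun γ' => S.tendsto_finiteCost c π₀ γ' hβ₀.le hβ₁, ?_⟩⟩
  obtain ⟨γ, hγ⟩ := S.exists_hasControlledPredictorStructure π₀ fun _ => g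
  have hcost := hγ.discountedCost_eq_valueFunction hβ₀.le hβ₁ fun _ => hopt
  refine ⟨γ, hγ, ⟨⟨γ, rfl⟩, ?_⟩, ?_⟩
  · rintro _ ⟨γ', rfl⟩
    exact hcost.trans_le (S.valueFunction_le_discountedCost c π₀ γ' hβ₀.le hβ₁)
  · rw [hγ.finiteReducedCost_eq]
    exact S.tendsto_finiteCost c π₀ γ hβ₀.le hβ₁
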